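/- Fix a continuous activation function $\sigma:\mathbb R\to\mathbb R$ that is not a polynomial. An MLP is a map $\mathbb R^a\to\mathbb R^b$ obtained by alternating affine maps with the entrywise application of $\sigma$, with at least one hidden layer, hidden layers of arbitrary finite widths, and an affine output layer. A SignNet $\mathbb R^{n\times k}\to\mathbb R^{n'\times k}$ is a map $$\mathrm{SignNet}(V)=\rho\big([\phi(v_j)+\phi(-v_j)]_{j=1,\dots,k}\big),\qquad V=[v_1,\dots,v_k],$$ where, for some $d$, $\phi:\mathbb R^n\to\mathbb R^d$ and $\rho:\mathbb R^{k\times d}\to\mathbb R^{n'\times k}$ are MLPs. Let $\odot$ be the elementwise product and $|v|$ the elementwise absolute value. A function $f:\mathbb R^{n\times k}\to\mathbb R^{n'\times k}$ is sign equivariant if $f(VS)=f(V)S$ for every $k\times k$ diagonal matrix $S$ with diagonal entries in $\{-1,1\}$; a function $f:\mathbb R^k\to\mathbb R^k$ is sign equivariant if $f(s\odot v)=s\odot f(v)$ for all $v\in\mathbb R^k$, $s\in\{-1,1\}^k$. A class $\mathcal F_{\mathrm m}$ of functions $\mathcal X\to\mathcal Y$ universally approximates a class $\mathcal F_{\mathrm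 t}$ of functions $\mathcal X\to\mathcal Y$ if for every compact $\mathcal D\subseteq\mathcal X$, every $f_{\mathrm t}\in\mathcal F_{\mathrm t}$ and every $\epsilon>0$ there is $f_{\mathrm m}\in\mathcal F_{\mathrm m}$ with $\|f_{\mathrm m}(x)-f_{\mathrm t}(x)\|<\epsilon$ for all $x\in\mathcal D$ (Euclidean norm on vectors, Frobenius norm on matrices). Then: 1. For every $k$, the functions $v\mapsto v\odot\mathrm{MLP}(|v|)$, with $\mathrm{MLP}:\mathbb R^k\to\mathbb R^k$ an MLP, universally approximate the continuous sign equivariant functions $\mathbb R^k\to\mathbb R^k$. 2. For all $n,n',k$, the compositions $f_2\circ f_1:\mathbb R^{n\times k}\to\mathbb R^{d\times k}\to\mathbb R^{n'\times k}$, over all hidden dimensions $d$, of two layers of the form $$f_l(V)=[W^{(l)}_1v_1,\dots,W^{(l)}_kv_k]\odot\mathrm{SignNet}_l(V),$$ where the $W^{(l)}_j$ are arbitrary linear maps and $\mathrm{SignNet}_l$ is a SignNet, universally approximate the continuous sign equivariant functions $\mathbb R^{n\times k}\to\mathbb R^{n'\times k}$. -/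

import Mathlib

-- Real matrices carry the Frobenius norm.
attribute [local instance] Matrix.frobeniusNormedAddCommGroup

namespace SignEquivariant

/-- `Fm` is universal with respect to `Ft`: every member of `Ft` is approximated by members
of `Fm`, uniformly on every compact set and to any accuracy. -/
def IsUniversal {X Y : Type} [TopologicalSpace X] [NormedAddCommGroup Y]
    (Fm Ft : Set (X → Y)) : Prop :=
  ∀ D : Set X, IsCompact D → ∀ f ∈ Ft, ∀ ε : ℝ, 0 < ε →
    ∃ g ∈ Fm, ∀ x ∈ D, ‖g x - f x‖ < ε

/-- `s` is a vector of signs, i.e. an element of `{-1, 1}^k`. -/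
def IsSign {k : ℕ} (s : Fin k → ℝ) : Prop := ∀ j, s j = 1 ∨ s j = -1

/-- Elementwise product of two vectors in `ℝ^k`. -/
def vmul {k : ℕ} (v w : EuclideanSpace ℝ (Fin k)) : EuclideanSpace ℝ (Fin k) :=
  WithLp.toLp 2 (fun i => v i * w i)

/-- Sign equivariance of `f : ℝ^k → ℝ^k`: `f (s ⊙ v) = s ⊙ f v`. -/
def VecSignEquivariant {k : ℕ}
    (f : EuclideanSpace ℝ (Fin k) → EuclideanSpace ℝ (Fin k)) : Prop :=
  ∀ s : Fin k → ℝ, IsSign s → ∀ v, f (vmul (WithLp.toLp 2 s) v) = vmul (WithLp.toLp 2 s) (f v)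

/-- Sign equivariance of `f : ℝ^{n × k} → ℝ^{n' × k}`: `f (V S) = f (V) S` for all diagonal
matrices `S` with diagonal entries `± 1`. -/
def MatSignEquivariant {n n' k : ℕ}
    (f : Matrix (Fin n) (Fin k) ℝ → Matrix (Fin n') (Fin k) ℝ) : Prop :=
  ∀ s : Fin k → ℝ, IsSign s → ∀ V, f (V * Matrix.diagonal s) = f V * Matrix.diagonal s

/-- Multilayer perceptrons `ℝ^ι → ℝ^κ` with activation `σ`: affine maps alternating with the
entrywise activation, with one or more hidden layers of arbitrary finite widths and an affine
output layer. -/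
inductive IsMLP (σ : ℝ → ℝ) {ι : Type} [Fintype ι] :
    {κ : Type} → ((ι → ℝ) → (κ → ℝ)) → Prop
  | oneHidden {κ : Type} {m : ℕ} (A : Matrix (Fin m) ι ℝ) (a : Fin m → ℝ)
      (B : Matrix κ (Fin m) ℝ) (b : κ → ℝ) :
      IsMLP σ (fun x : ι → ℝ => B.mulVec (fun i => σ ((A.mulVec x + a) i)) + b)
  | addHidden {κ : Type} {m : ℕ} {g : (ι → ℝ) → (Fin m → ℝ)} (hg : IsMLP σ g)
      (B : Matrix κ (Fin m) ℝ) (b : κ → ℝ) :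
      IsMLP σ (fun x : ι → ℝ => B.mulVec (fun i => σ (g x i)) + b)

/-- SignNets `ℝ^{n × k} → ℝ^{n' × k}`, i.e. `V ↦ ρ ([φ (v_j) + φ (-v_j)]_{j = 1, …, k})`
for multilayer perceptrons `φ : ℝ^n → ℝ^d` and `ρ : ℝ^{k × d} → ℝ^{n' × k}`, where `v_j` is
the `j`-th column of `V`. -/
def IsSignNet (σ : ℝ → ℝ) {n n' k : ℕ}
    (S : Matrix (Fin n) (Fin k) ℝ → Matrix (Fin n') (Fin k) ℝ) : Prop :=
  ∃ (d : ℕ) (φ : (Fin n → ℝ) → (Fin d → ℝ)) (ρ : (Fin k × Fin d → ℝ) → (Fin n' × Fin k → ℝ)),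
    IsMLP σ φ ∧ IsMLP σ ρ ∧
    S = fun V => Matrix.of fun i j =>
      ρ (fun p => φ (V.col p.1) p.2 + φ (-V.col p.1) p.2) (i, j)

/-- Layers `V ↦ [W_1 v_1, …, W_k v_k] ⊙ SignNet (V)` with arbitrary linear maps
`W_j : ℝ^n → ℝ^{n'}`. -/
def IsLayer (σ : ℝ → ℝ) {n n' k : ℕ}
    (F : Matrix (Fin n) (Fin k) ℝ → Matrix (Fin n') (Fin k) ℝ) : Prop :=
  ∃ (W : Fin k → (Fin n → ℝ) →ₗ[ℝ] (Fin n' → ℝ))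
    (S : Matrix (Fin n) (Fin k) ℝ → Matrix (Fin n') (Fin k) ℝ),
    IsSignNet σ S ∧
    F = fun V => Matrix.hadamard (Matrix.of fun i j => W j (V.col j) i) (S V)

/-- The functions `v ↦ v ⊙ MLP (|v|)` on `ℝ^k`, with `|v|` the elementwise absolute value. -/
def vecModel (σ : ℝ → ℝ) (k : ℕ) :
    Set (EuclideanSpace ℝ (Fin k) → EuclideanSpace ℝ (Fin k)) :=
  {g | ∃ M : (Fin k → ℝ) → (Fin k → ℝ), IsMLP σ M ∧
    g = fun v => vmul v (WithLp.toLp 2 (M fun i => |v i|))}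

/-- The two-layer compositions `f₂ ∘ f₁ : ℝ^{n × k} → ℝ^{d × k} → ℝ^{n' × k}`, for any hidden
dimension `d`. -/
def matModel (σ : ℝ → ℝ) (n n' k : ℕ) :
    Set (Matrix (Fin n) (Fin k) ℝ → Matrix (Fin n') (Fin k) ℝ) :=
  {g | ∃ (d : ℕ) (f₁ : Matrix (Fin n) (Fin k) ℝ → Matrix (Fin d) (Fin k) ℝ)
    (f₂ : Matrix (Fin d) (Fin k) ℝ → Matrix (Fin n') (Fin k) ℝ),
    IsLayer σ f₁ ∧ IsLayer σ f₂ ∧ g = f₂ ∘ f₁}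

end SignEquivariant

/-!
Universality of the two models rests on the universal approximation theorem for a continuous
activation `σ` that is not a polynomial (`exists_isMLP_approx`). Let `S` be the closed span, in
`C(K, ℝ)`, of the functions `x ↦ σ (a ⬝ᵥ x + b)`. Mollifications of `σ` are averages of its
translates, so `S` contains `x ↦ g (w * a ⬝ᵥ x + b)` for every mollification `g`, and with it the
derivatives in `w`, among them the multiples `g⁽ʲ⁾ (b) • (a ⬝ᵥ x) ^ j` at `w = 0`. For each `j` some
`g` and `b` have `g⁽ʲ⁾ (b) ≠ 0`; otherwise `σ` would be a pointwise limit of polynomials of degree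
less than `j`, hence a polynomial. So `S` contains all powers of linear forms, hence their
exponentials, and these span a point-separating algebra: `S` is everything by Stone–Weierstrass
(`eq_top_of_ridge_mem`).

For vectors, sign equivariance gives `v_i * f (|v|)_i = |v_i| * f (v)_i`, and `f (v)_i` vanishes with
`v_i`. Therefore `v ⊙ G (|v|)` with the continuous `G (u)_i = f (u)_i / max u_i δ` is uniformly close
to `f` on compact sets for small `δ` (`exists_abs_mul_div_max_sub_lt`), and a perceptron
approximates `G`.

For matrices, a sign invariant function of `V` depends only on the matrices `v_j v_jᵀ`, and each of
these is a sum `φ (v_j) + φ (-v_j)` with `φ v = v vᵀ / 2`; so SignNets approximate all continuous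
sign invariant functions
(`exists_isSignNet_approx`). A sign equivariant `f` is uniformly close to
`∑ a, V a j * (V a j * f V i j / max ‖v_j‖² δ)`, where the second factor is sign invariant. The
first layer computes the summands, with one hidden row for each pair `(a, i)`; the second layer has
SignNet constantly equal to `1`, and its linear maps sum over `a`.
-/

namespace SignEquivariant

open scoped Convolution ContDiff Topology
open MeasureTheory Filter

/-! ### Smooth functions with a vanishing higher derivative -/

/-- The polynomial functions `ℝ → ℝ` of degree less than `j`. -/
def polyLT (j : ℕ) : Submodule ℝ (ℝ → ℝ) :=
  Submodule.span ℝ (Set.range fun (i : Fin j) (x : ℝ) => x ^ (i : ℕ))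

theorem isClosed_polyLT (j : ℕ) : IsClosed (polyLT j : Set (ℝ → ℝ)) := by
  have : FiniteDimensional ℝ (polyLT j) :=
    FiniteDimensional.span_of_finite ℝ (Set.finite_range _)
  exact Submodule.closed_of_finiteDimensional _

theorem exists_polynomial_of_mem_polyLT {j : ℕ} {f : ℝ → ℝ} (hf : f ∈ polyLT j) :
    ∃ p : Polynomial ℝ, ∀ x, f x = p.eval x := by
  induction hf using Submodule.span_induction with
  | mem f hf =>
    obtain ⟨i, rfl⟩ := hf
    exact ⟨Polynomial.X ^ (i : ℕ), fun x => by simp⟩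
  | zero => exact ⟨0, fun x => by simp⟩
  | add f g _ _ hf hg =>
    obtain ⟨p, hp⟩ := hf
    obtain ⟨q, hq⟩ := hg
    exact ⟨p + q, fun x => by simp [hp, hq]⟩
  | smul c f _ hf =>
    obtain ⟨p, hp⟩ := hf
    exact ⟨Polynomial.C c * p, fun x => by simp [hp]⟩

theorem exists_antideriv_mem_polyLT {j : ℕ} {f : ℝ → ℝ} (hf : f ∈ polyLT j) :
    ∃ F ∈ polyLT (j + 1), ∀ x, HasDerivAt F (f x) x := by
  induction hf using Submodule.span_induction with
  | mem f hf =>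
    obtain ⟨i, rfl⟩ := hf
    refine ⟨((i : ℝ) + 1)⁻¹ • fun x : ℝ => x ^ ((i : ℕ) + 1),
      Submodule.smul_mem _ _ (Submodule.subset_span ⟨i.succ, by simp⟩), fun x => ?_⟩
    have h := (hasDerivAt_pow ((i : ℕ) + 1) x).const_smul ((i : ℝ) + 1)⁻¹
    have h0 : (i : ℝ) + 1 ≠ 0 := by positivity
    refine h.congr_deriv ?_
    simp only [Nat.cast_add, Nat.cast_one, Nat.add_sub_cancel, smul_eq_mul]
    field_simp
  | zero => exact ⟨0, Submodule.zero_mem _, fun x => hasDerivAt_const x 0⟩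
  | add f g _ _ hf hg =>
    obtain ⟨F, hF, hF'⟩ := hf
    obtain ⟨G, hG, hG'⟩ := hg
    exact ⟨F + G, Submodule.add_mem _ hF hG, fun x => (hF' x).add (hG' x)⟩
  | smul c f _ hf =>
    obtain ⟨F, hF, hF'⟩ := hf
    exact ⟨c • F, Submodule.smul_mem _ _ hF, fun x => (hF' x).const_smul c⟩

theorem mem_polyLT_of_iteratedDeriv_eq_zero (j : ℕ) {g : ℝ → ℝ} (hg : ContDiff ℝ ∞ g)
    (h : ∀ x, iteratedDeriv j g x = 0) : g ∈ polyLT j := by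
  induction j generalizing g with
  | zero =>
    have : g = 0 := funext fun x => by simpa using h x
    exact this ▸ Submodule.zero_mem _
  | succ j ih =>
    have hd : ContDiff ℝ ∞ (deriv g) := (contDiff_infty_iff_deriv.1 hg).2
    have hg' : ∀ x, HasDerivAt g (deriv g x) x := fun x =>
      (hg.differentiable (by simp) x).hasDerivAt
    obtain ⟨F, hF, hF'⟩ := exists_antideriv_mem_polyLT
      (ih hd fun x => by rw [← iteratedDeriv_succ']; exact h x)
    have hder : ∀ x, HasDerivAt (fun x => g x - F x) 0 x := fun x => by
      simpa using (hg' x).fun_sub (hF' x)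
    have hconst : ∀ x, g x - F x = g 0 - F 0 := fun x =>
      is_const_of_deriv_eq_zero (fun x => (hder x).differentiableAt) (fun x => (hder x).deriv) x 0
    have : g = F + (g 0 - F 0) • fun x : ℝ => x ^ ((0 : Fin (j + 1)) : ℕ) := by
      ext x
      have := hconst x
      simp
      linarith
    rw [this]
    exact Submodule.add_mem _ hF (Submodule.smul_mem _ _ (Submodule.subset_span ⟨0, rfl⟩))

/-! ### Mollification -/

/-- The mollification of `σ` by a bump function centred at the origin. -/
noncomputable def mollify (φ : ContDiffBump (0 : ℝ)) (σ : ℝ → ℝ) : ℝ → ℝ :=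
  φ.normed volume ⋆[ContinuousLinearMap.lsmul ℝ ℝ, volume] σ

theorem mollify_apply (φ : ContDiffBump (0 : ℝ)) (σ : ℝ → ℝ) (x : ℝ) :
    mollify φ σ x = ∫ t, φ.normed volume t * σ (x - t) := rfl

theorem contDiff_mollify (φ : ContDiffBump (0 : ℝ)) {σ : ℝ → ℝ} (hσ : Continuous σ) :
    ContDiff ℝ ∞ (mollify φ σ) :=
  φ.hasCompactSupport_normed.contDiff_convolution_left _ φ.contDiff_normed hσ.locallyIntegrable

/-- If the `j`-th derivatives of all mollifications of `σ` vanished identically, all of them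
would be polynomials of degree less than `j`, and so would their pointwise limit `σ`. -/
theorem exists_iteratedDeriv_mollify_ne_zero {σ : ℝ → ℝ} (hσ : Continuous σ)
    (hσ_nonpoly : ¬ ∃ p : Polynomial ℝ, ∀ x, σ x = p.eval x) (j : ℕ) :
    ∃ (φ : ContDiffBump (0 : ℝ)) (b : ℝ), iteratedDeriv j (mollify φ σ) b ≠ 0 := by
  by_contra! h
  let φ : ℕ → ContDiffBump (0 : ℝ) := fun n =>
    ⟨(1 / ((n : ℝ) + 1)) / 2, 1 / ((n : ℝ) + 1), by positivity, half_lt_self (by positivity)⟩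
  have hφ : Tendsto (fun n => (φ n).rOut) atTop (𝓝 0) := tendsto_one_div_add_atTop_nhds_zero_nat
  have hlim : Tendsto (fun n => mollify (φ n) σ) atTop (𝓝 σ) := by
    rw [tendsto_pi_nhds]
    exact fun x => ContDiffBump.convolution_tendsto_right_of_continuous hφ hσ x
  exact hσ_nonpoly <| exists_polynomial_of_mem_polyLT <|
    (isClosed_polyLT j).mem_of_tendsto hlim <| Eventually.of_forall fun n =>
      mem_polyLT_of_iteratedDeriv_eq_zero j (contDiff_mollify (φ n) hσ) (h (φ n))

/-! ### Closed subspaces containing ridge functions -/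

section Ridge

variable {X : Type*} [TopologicalSpace X] [CompactSpace X]

/-- A mollification of `σ` is an average of translates of `σ`, which a closed subspace contains
with the translates. -/
theorem mollify_comp_mem {S : Submodule ℝ C(X, ℝ)} (hS : IsClosed (S : Set C(X, ℝ)))
    (σ : C(ℝ, ℝ)) (L : C(X, ℝ))
    (h : ∀ b : ℝ, σ.comp (L + ContinuousMap.const X b) ∈ S)
    (φ : ContDiffBump (0 : ℝ)) (F : C(X, ℝ)) (hF : ∀ x, F x = mollify φ σ (L x)) : F ∈ S := by
  let G : C(ℝ, C(X, ℝ)) := ContinuousMap.curry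
    ⟨fun p : ℝ × X => φ.normed volume p.1 * σ (L p.2 - p.1), by
      have := φ.continuous_normed (μ := volume)
      fun_prop⟩
  have hG : ∀ t, G t ∈ S := fun t => by
    have : G t = φ.normed volume t • σ.comp (L + ContinuousMap.const X (-t)) := by
      ext x
      simp [G, sub_eq_add_neg]
    rw [this]
    exact S.smul_mem _ (h _)
  have hGs : HasCompactSupport G := by
    refine φ.hasCompactSupport_normed (μ := volume) |>.mono' ?_
    refine (Function.support_subset_iff'.2 fun t ht => ?_).trans subset_closure
    ext x
    simp [G, Function.notMem_support.1 ht]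
  have hint : Integrable G := G.continuous.integrable_of_hasCompactSupport hGs
  have : CompleteSpace S := hS.completeSpace_coe
  have hmem : ∫ t, G t ∈ S := by
    have := S.subtypeₗᵢ.integral_comp_comm (𝕜 := ℝ) (μ := volume) fun t => (⟨G t, hG t⟩ : S)
    exact this ▸ Subtype.property _
  convert hmem
  ext x
  have := (ContinuousMap.evalCLM ℝ x).integral_comp_comm hint
  rw [hF, mollify_apply]
  exact this

/-- Differentiating `w ↦ g (w L + b)` with values in `C(X, ℝ)`: a closed subspace that contains
the curve contains its derivatives. -/
theorem pow_mul_iteratedDeriv_mem {S : Submodule ℝ C(X, ℝ)} (hS : IsClosed (S : Set C(X, ℝ)))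
    (L : C(X, ℝ)) {g : ℝ → ℝ} (hg : ContDiff ℝ ∞ g) (b : ℝ)
    (h : ∀ (w : ℝ) (F : C(X, ℝ)), (∀ x, F x = g (w * L x + b)) → F ∈ S) (j : ℕ) :
    ∀ (w : ℝ) (F : C(X, ℝ)), (∀ x, F x = L x ^ j * iteratedDeriv j g (w * L x + b)) → F ∈ S := by
  induction j with
  | zero => simpa using h
  | succ j ih =>
    intro w F hF
    have hc : ∀ i, Continuous (iteratedDeriv i g) := fun i =>
      hg.continuous_iteratedDeriv i (by exact_mod_cast le_top)
    let G : ℕ → C(ℝ, C(X, ℝ)) := fun i => ContinuousMap.curry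
      ⟨fun p : ℝ × X => L p.2 ^ i * iteratedDeriv i g (p.1 * L p.2 + b), by
        have := hc i
        fun_prop⟩
    -- The fundamental theorem of calculus, checked pointwise, turns continuity of `G (j + 1)` into
    -- uniform convergence of the difference quotients of `G j`.
    have hGd : ∀ v, G j v = G j w + ∫ s in w..v, G (j + 1) s := fun v => by
      ext x
      have hint := (G (j + 1)).continuous.intervalIntegrable w v (μ := volume)
      have h1 := (ContinuousMap.evalCLM ℝ x).intervalIntegral_comp_comm hint
      have hd : ∀ s, HasDerivAt (fun s => L x ^ j * iteratedDeriv j g (s * L x + b))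
          (L x ^ (j + 1) * iteratedDeriv (j + 1) g (s * L x + b)) s := fun s => by
        have h2 : HasDerivAt (iteratedDeriv j g) (iteratedDeriv (j + 1) g (s * L x + b))
            (s * L x + b) := by
          rw [iteratedDeriv_succ]
          exact (hg.differentiable_iteratedDeriv j (by exact_mod_cast ENat.natCast_lt_top j)
            _).hasDerivAt
        have h3 : HasDerivAt (fun s => s * L x + b) (L x) s := by
          simpa using ((hasDerivAt_id s).mul_const (L x)).add_const b
        exact ((h2.comp s h3).const_mul (L x ^ j)).congr_deriv (by ring)
      have h4 := intervalIntegral.integral_eq_sub_of_hasDerivAt (fun s _ => hd s)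
        (a := w) (b := v) (Continuous.intervalIntegrable (by have := hc (j + 1); fun_prop) _ _)
      have h5 : (∫ s in w..v, G (j + 1) s) x = G j v x - G j w x := h1.symm.trans h4
      rw [ContinuousMap.add_apply, h5]
      ring
    have hder : HasDerivAt (G j) (G (j + 1) w) w := by
      have := intervalIntegral.integral_hasDerivAt_right
        ((G (j + 1)).continuous.intervalIntegrable w w (μ := volume))
        ((G (j + 1)).continuous.stronglyMeasurableAtFilter _ _)
        (G (j + 1)).continuous.continuousAt
      exact (this.const_add (G j w)).congr_of_eventuallyEq (Eventually.of_forall hGd)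
    have hFG : F = G (j + 1) w := by
      ext x
      exact hF x
    have hmem : ∀ v, G j v ∈ S := fun v => ih v _ fun x => rfl
    rw [hFG]
    -- The derivative is the limit of slopes of a curve in `S`.
    refine hS.mem_of_tendsto hder.tendsto_slope (Eventually.of_forall fun v => ?_)
    exact S.smul_mem _ (S.sub_mem (hmem v) (hmem w))

theorem pow_mem_of_ridge_mem {S : Submodule ℝ C(X, ℝ)} (hS : IsClosed (S : Set C(X, ℝ)))
    (σ : C(ℝ, ℝ)) (hσ_nonpoly : ¬ ∃ p : Polynomial ℝ, ∀ x, σ x = p.eval x) (L : C(X, ℝ))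
    (h : ∀ w b : ℝ, σ.comp (w • L + ContinuousMap.const X b) ∈ S) (j : ℕ) : L ^ j ∈ S := by
  obtain ⟨φ, b, hb⟩ := exists_iteratedDeriv_mollify_ne_zero σ.continuous hσ_nonpoly j
  have := pow_mul_iteratedDeriv_mem hS L (contDiff_mollify φ σ.continuous) b
    (fun w F hF => mollify_comp_mem hS σ (w • L + ContinuousMap.const X b) (fun c => by
      have := h w (b + c)
      convert this using 2
      ext x
      simp [add_assoc]) φ F (by simpa using hF)) j 0
    (iteratedDeriv j (mollify φ σ) b • L ^ j) (fun x => by simp [mul_comm])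
  exact (S.smul_mem_iff hb).1 this

/-- The density of ridge functions. The subspace contains the powers of the members `L` of `Λ`,
hence also the functions `exp L`, whose span is an algebra. -/
theorem eq_top_of_ridge_mem {S : Submodule ℝ C(X, ℝ)} (hS : IsClosed (S : Set C(X, ℝ)))
    (σ : C(ℝ, ℝ)) (hσ_nonpoly : ¬ ∃ p : Polynomial ℝ, ∀ x, σ x = p.eval x)
    (Λ : Submodule ℝ C(X, ℝ)) (hΛ : ∀ x y, x ≠ y → ∃ L ∈ Λ, L x ≠ L y)
    (h : ∀ L ∈ Λ, ∀ b : ℝ, σ.comp (L + ContinuousMap.const X b) ∈ S) : S = ⊤ := by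
  have hexp : ∀ L ∈ Λ, NormedSpace.exp L ∈ S := fun L hL => by
    refine hS.mem_of_tendsto (NormedSpace.exp_series_hasSum_exp' (𝕂 := ℝ) L)
      (Eventually.of_forall fun s => S.sum_mem fun j _ => S.smul_mem _ ?_)
    exact pow_mem_of_ridge_mem hS σ hσ_nonpoly L (fun w b => h _ (Λ.smul_mem w hL) b) j
  let E : Submonoid C(X, ℝ) :=
    { carrier := NormedSpace.exp '' (Λ : Set C(X, ℝ))
      one_mem' := ⟨0, Λ.zero_mem, NormedSpace.exp_zero⟩
      mul_mem' := by
        rintro _ _ ⟨L, hL, rfl⟩ ⟨L', hL', rfl⟩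
        exact ⟨L + L', Λ.add_mem hL hL', NormedSpace.exp_add⟩ }
  let A : Subalgebra ℝ C(X, ℝ) := Algebra.adjoin ℝ (E : Set C(X, ℝ))
  have hAS : (A : Set C(X, ℝ)) ⊆ S := by
    have : Subalgebra.toSubmodule A ≤ S := by
      rw [Algebra.adjoin_eq_span, Submonoid.closure_eq, Submodule.span_le]
      rintro _ ⟨L, hL, rfl⟩
      exact hexp L hL
    exact this
  have hsep : A.SeparatesPoints := fun x y hxy => by
    obtain ⟨L, hL, hne⟩ := hΛ x y hxy
    refine ⟨_, ⟨NormedSpace.exp L, Algebra.subset_adjoin ⟨L, hL, rfl⟩, rfl⟩, fun heq => hne ?_⟩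
    have hev : ∀ z, (NormedSpace.exp L) z = Real.exp (L z) := fun z => by
      rw [Real.exp_eq_exp_ℝ]
      exact NormedSpace.map_exp (ContinuousMap.evalAlgHom ℝ ℝ z)
        (continuous_eval_const z) L
    simpa [hev] using heq
  have htop := ContinuousMap.subalgebra_topologicalClosure_eq_top_of_separatesPoints A hsep
  refine (Submodule.eq_top_iff').2 fun f => ?_
  have hf : f ∈ A.topologicalClosure := htop ▸ Algebra.mem_top
  exact closure_minimal hAS hS hf

end Ridge

/-! ### Universality of multilayer perceptrons -/

theorem IsMLP.continuous {σ : ℝ → ℝ} (hσ : Continuous σ) {ι κ : Type} [Fintype ι]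
    {M : (ι → ℝ) → (κ → ℝ)} (hM : IsMLP σ M) : Continuous M := by
  induction hM with
  | oneHidden A a B b =>
    have hA : Continuous fun x : ι → ℝ => A.mulVec x :=
      (continuous_const (y := A)).matrix_mulVec continuous_id
    exact ((continuous_const (y := B)).matrix_mulVec (continuous_pi fun i =>
      hσ.comp ((continuous_apply i).comp (hA.add continuous_const)))).add continuous_const
  | addHidden _ B b ih =>
    exact ((continuous_const (y := B)).matrix_mulVec (continuous_pi fun i =>
      hσ.comp ((continuous_apply i).comp ih))).add continuous_const

theorem isMLP_const (σ : ℝ → ℝ) {ι κ : Type} [Fintype ι] (b : κ → ℝ) :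
    IsMLP σ (fun _ : ι → ℝ => b) := by
  simpa using IsMLP.oneHidden (σ := σ) (m := 0) (0 : Matrix (Fin 0) ι ℝ) 0
    (0 : Matrix κ (Fin 0) ℝ) b

/-- Universal approximation by perceptrons with one hidden layer. The coordinates of the target
are approximated separately; the hidden layer collects the units of all the approximants. -/
theorem exists_isMLP_approx {σ : ℝ → ℝ} (hσ : Continuous σ)
    (hσ_nonpoly : ¬ ∃ p : Polynomial ℝ, ∀ x, σ x = p.eval x) {ι κ : Type} [Fintype ι] [Finite κ]
    {K : Set (ι → ℝ)} (hK : IsCompact K) {f : (ι → ℝ) → (κ → ℝ)} (hf : Continuous f)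
    {ε : ℝ} (hε : 0 < ε) :
    ∃ M, IsMLP σ M ∧ ∀ x ∈ K, ∀ i, |M x i - f x i| < ε := by
  classical
  have := Fintype.ofFinite κ
  have : CompactSpace K := isCompact_iff_compactSpace.1 hK
  let ℓ : (ι → ℝ) →ₗ[ℝ] C(K, ℝ) :=
    { toFun := fun a => ⟨fun x => a ⬝ᵥ x.1,
        (continuous_const (y := a)).dotProduct continuous_subtype_val⟩
      map_add' := fun a b => by ext x; simp [add_dotProduct]
      map_smul' := fun c a => by ext x; simp [smul_dotProduct] }
  let r : (ι → ℝ) × ℝ → C(K, ℝ) := fun p =>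
    (⟨σ, hσ⟩ : C(ℝ, ℝ)).comp (ℓ p.1 + ContinuousMap.const K p.2)
  have htop : (Submodule.span ℝ (Set.range r)).topologicalClosure = ⊤ := by
    refine eq_top_of_ridge_mem (Submodule.isClosed_topologicalClosure _) ⟨σ, hσ⟩ hσ_nonpoly
      (LinearMap.range ℓ) (fun x y hxy => ?_) ?_
    · obtain ⟨i, hi⟩ := Function.ne_iff.1 (Subtype.coe_injective.ne hxy)
      exact ⟨ℓ (Pi.single i 1), ⟨_, rfl⟩, by simpa [ℓ] using hi⟩
    · rintro _ ⟨a, rfl⟩ b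
      exact Submodule.le_topologicalClosure _ (Submodule.subset_span ⟨(a, b), rfl⟩)
  have happ : ∀ i, ∃ c : ((ι → ℝ) × ℝ) →₀ ℝ,
      ∀ x : K, |(c.sum fun p t => t • r p) x - f x i| < ε := fun i => by
    -- The `i`-th coordinate lies in the closure of the span of the ridge functions.
    let F : C(K, ℝ) := ⟨fun x => f x i, by fun_prop⟩
    have hF : F ∈ closure (Submodule.span ℝ (Set.range r) : Set C(K, ℝ)) := by
      rw [← Submodule.topologicalClosure_coe, htop]
      trivial
    obtain ⟨g, hg, hd⟩ := Metric.mem_closure_iff.1 hF ε hε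
    obtain ⟨c, rfl⟩ := Finsupp.mem_span_range_iff_exists_finsupp.1 hg
    refine ⟨c, fun x => ?_⟩
    have := (ContinuousMap.dist_apply_le_dist x).trans_lt hd
    rwa [dist_comm, Real.dist_eq] at this
  choose c hc using happ
  let s : Finset ((ι → ℝ) × ℝ) := Finset.univ.biUnion fun i => (c i).support
  let e := s.equivFin
  refine ⟨_, IsMLP.oneHidden (Matrix.of fun h => (e.symm h).1.1) (fun h => (e.symm h).1.2)
    (Matrix.of fun i h => c i (e.symm h).1) 0, fun x hx i => ?_⟩
  have hsub : (c i).support ⊆ s := Finset.subset_biUnion_of_mem (fun i => (c i).support)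
    (Finset.mem_univ i)
  have h1 : (c i).sum (fun p t => t • r p) = ∑ p ∈ s, c i p • r p :=
    Finsupp.sum_of_support_subset _ hsub _ (by simp)
  have h2 := hc i ⟨x, hx⟩
  rw [h1, ← Finset.sum_coe_sort s, ← e.symm.sum_comp] at h2
  simpa [Matrix.mulVec, dotProduct, r, ℓ] using h2

/-! ### Uniform estimates on compact sets -/

theorem exists_pos_forall_abs_lt {X : Type*} [TopologicalSpace X] {D : Set X} (hD : IsCompact D)
    {q h : X → ℝ} (hq : Continuous q) (hh : Continuous h) (hqh : ∀ x, q x = 0 → h x = 0)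
    {ε : ℝ} (hε : 0 < ε) : ∃ δ > 0, ∀ x ∈ D, |q x| < δ → |h x| < ε := by
  have hC : IsCompact (D ∩ {x | ε ≤ |h x|}) :=
    hD.inter_right (isClosed_le continuous_const hh.abs)
  rcases (D ∩ {x | ε ≤ |h x|}).eq_empty_or_nonempty with he | hne
  · refine ⟨1, one_pos, fun x hx _ => ?_⟩
    by_contra hlt
    exact he.le ⟨hx, not_lt.1 hlt⟩
  · obtain ⟨x₀, hx₀, hmin⟩ := hC.exists_isMinOn hne hq.abs.continuousOn
    refine ⟨|q x₀|, abs_pos.2 fun h0 => ?_, fun x hx hlt => ?_⟩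
    · have : ε ≤ |h x₀| := hx₀.2
      rw [hqh x₀ h0, abs_zero] at this
      exact this.not_gt hε
    · by_contra hle
      exact (hmin ⟨hx, not_lt.1 hle⟩).not_gt hlt

/-- If `h` vanishes where `q` does, then `q * (h / max q δ)` is close to `h`: the two agree where
`q ≥ δ`, and elsewhere `h` is small. -/
theorem exists_abs_mul_div_max_sub_lt {X : Type*} [TopologicalSpace X] {D : Set X}
    (hD : IsCompact D) {q h : X → ℝ} (hq : Continuous q) (hh : Continuous h)
    (hq0 : ∀ x, 0 ≤ q x) (hqh : ∀ x, q x = 0 → h x = 0) {ε : ℝ} (hε : 0 < ε) :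
    ∃ δ > 0, ∀ x ∈ D, |q x * (h x / max (q x) δ) - h x| < ε := by
  obtain ⟨δ, hδ, H⟩ := exists_pos_forall_abs_lt hD hq hh hqh hε
  refine ⟨δ, hδ, fun x hx => ?_⟩
  rcases lt_or_ge (q x) δ with hlt | hge
  · have hhx := H x hx (by rwa [abs_of_nonneg (hq0 x)])
    have h1 : q x * (h x / max (q x) δ) - h x = -((1 - q x / δ) * h x) := by
      rw [max_eq_right hlt.le]
      ring
    have h2 : q x / δ ≤ 1 := (div_le_one hδ).2 hlt.le
    have h3 : 0 ≤ q x / δ := div_nonneg (hq0 x) hδ.le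
    rw [h1, abs_neg, abs_mul, abs_of_nonneg (sub_nonneg.2 h2)]
    exact (mul_le_of_le_one_left (abs_nonneg _) (by linarith)).trans_lt hhx
  · have : q x ≠ 0 := (hδ.trans_le hge).ne'
    rw [max_eq_left hge, mul_div_cancel₀ _ this, sub_self, abs_zero]
    exact hε

theorem exists_pos_norm_lt_of_abs_lt {k : ℕ} {ε : ℝ} (hε : 0 < ε) :
    ∃ η > 0, ∀ x : EuclideanSpace ℝ (Fin k), (∀ i, |x i| < η) → ‖x‖ < ε := by
  have hc : Continuous fun y : Fin k → ℝ => ‖WithLp.toLp 2 y‖ := by fun_prop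
  obtain ⟨η, hη, H⟩ := Metric.continuous_iff.1 hc 0 ε hε
  refine ⟨η, hη, fun x hx => ?_⟩
  have := H x.ofLp ((dist_pi_lt_iff hη).2 fun i => by simpa using hx i)
  simpa using this

theorem exists_pos_frobenius_norm_lt_of_abs_lt {m k : ℕ} {ε : ℝ} (hε : 0 < ε) :
    ∃ η > 0, ∀ A : Matrix (Fin m) (Fin k) ℝ, (∀ i j, |A i j| < η) → ‖A‖ < ε := by
  have hc : Continuous fun y : Fin m → Fin k → ℝ =>
      (∑ i, ∑ j, ‖y i j‖ ^ (2 : ℝ)) ^ (1 / 2 : ℝ) := by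
    refine Continuous.rpow_const ?_ fun _ => Or.inr (by norm_num)
    exact continuous_finsetSum _ fun i _ => continuous_finsetSum _ fun j _ =>
      Continuous.rpow_const (by fun_prop) fun _ => Or.inr (by norm_num)
  obtain ⟨η, hη, H⟩ := Metric.continuous_iff.1 hc 0 ε hε
  refine ⟨η, hη, fun A hA => ?_⟩
  have := H (fun i j => A i j) ((dist_pi_lt_iff hη).2 fun i => (dist_pi_lt_iff hη).2 fun j => by
    simpa using hA i j)
  rw [Matrix.frobenius_norm_def]
  refine lt_of_le_of_lt ?_ this
  rw [Real.dist_eq]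
  refine le_trans (le_of_eq ?_) (le_abs_self _)
  simp

/-- Factorization through a continuous map on a compact set: the map is a quotient map onto its
image, and Tietze's theorem extends from there. -/
theorem exists_continuous_factor {X Z κ : Type*} [TopologicalSpace X] [TopologicalSpace Z]
    [T4Space Z] {D : Set X} (hD : IsCompact D) {π : X → Z} (hπ : Continuous π)
    {g : X → κ → ℝ} (hg : Continuous g) (h : ∀ x ∈ D, ∀ y ∈ D, π x = π y → g x = g y) :
    ∃ G : Z → κ → ℝ, Continuous G ∧ ∀ x ∈ D, G (π x) = g x := by
  have : CompactSpace D := isCompact_iff_compactSpace.1 hD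
  let p : C(D, π '' D) := ⟨fun x => ⟨π x, x, x.2, rfl⟩, by fun_prop⟩
  have hp : Function.Surjective p := by
    rintro ⟨_, x, hx, rfl⟩
    exact ⟨⟨x, hx⟩, rfl⟩
  have hq : Topology.IsQuotientMap p := p.continuous.isClosedMap.isQuotientMap p.continuous hp
  let g' : C(D, κ → ℝ) := ⟨fun x => g x, by fun_prop⟩
  have hfac : Function.FactorsThrough g' p := fun x y hxy =>
    h x x.2 y y.2 (congrArg Subtype.val hxy)
  obtain ⟨G, hG⟩ := (hq.lift g' hfac).exists_restrict_eq (hD.image hπ).isClosed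
  refine ⟨G, G.continuous, fun x hx => ?_⟩
  have h1 : G (π x) = hq.lift g' hfac (p ⟨x, hx⟩) := DFunLike.congr_fun hG (p ⟨x, hx⟩)
  exact h1.trans (DFunLike.congr_fun (hq.lift_comp g' hfac) ⟨x, hx⟩)

/-! ### Sign equivariant functions of a vector -/

theorem exists_isSign_mul_abs {k : ℕ} (v : Fin k → ℝ) :
    ∃ s : Fin k → ℝ, IsSign s ∧ ∀ i, v i = s i * |v i| := by
  refine ⟨fun i => if 0 ≤ v i then 1 else -1, fun i => ?_, fun i => ?_⟩
  · by_cases h : 0 ≤ v i <;> simp [h]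
  · by_cases h : 0 ≤ v i
    · simp [h, abs_of_nonneg]
    · simp [h, abs_of_neg (not_le.1 h)]

theorem isUniversal_vecModel {σ : ℝ → ℝ} (hσ : Continuous σ)
    (hσ_nonpoly : ¬ ∃ p : Polynomial ℝ, ∀ x, σ x = p.eval x) (k : ℕ) :
    IsUniversal (vecModel σ k) {f | Continuous f ∧ VecSignEquivariant f} := by
  rintro D hD f ⟨hf, hs⟩ ε hε
  obtain ⟨η, hη, hnorm⟩ := exists_pos_norm_lt_of_abs_lt (k := k) hε
  -- Both sides are odd in `v_i` and even in the other coordinates, and they agree for `v = |v|`.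
  have hsym : ∀ v i, v i * f (WithLp.toLp 2 fun j => |v j|) i = |v i| * f v i := fun v i => by
    obtain ⟨s, hs1, hs2⟩ := exists_isSign_mul_abs v
    have h1 := hs s hs1 (WithLp.toLp 2 fun j => |v j|)
    have h2 : vmul (WithLp.toLp 2 s) (WithLp.toLp 2 fun j => |v j|) = v := by
      ext j
      exact (hs2 j).symm
    rw [h2] at h1
    have h3 : f v i = s i * f (WithLp.toLp 2 fun j => |v j|) i := by rw [h1]; rfl
    rw [h3]
    conv_lhs => rw [hs2 i]
    ring
  -- Flipping the sign of a vanishing `v_i` fixes `v` and negates `f v i`.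
  have hzero : ∀ i v, |v i| = 0 → f v i = 0 := fun i v hv => by
    have h1 : IsSign (Function.update (fun _ : Fin k => (1 : ℝ)) i (-1)) := fun j => by
      by_cases h : j = i
      · subst h; simp
      · simp [h]
    have h2 := hs _ h1 v
    have h3 : vmul (WithLp.toLp 2 (Function.update (fun _ : Fin k => (1 : ℝ)) i (-1))) v = v := by
      ext j
      by_cases h : j = i
      · subst h; simp [vmul, abs_eq_zero.1 hv]
      · simp [vmul, h]
    rw [h3] at h2
    have h4 : f v i = -1 * f v i := by
      conv_lhs => rw [h2]
      simp [vmul]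
    linarith
  have hδ : ∀ i, ∃ δ > 0, ∀ v ∈ D, |(|v i|) * (f v i / max |v i| δ) - f v i| < η / 2 := fun i =>
    exists_abs_mul_div_max_sub_lt hD (q := fun v : EuclideanSpace ℝ (Fin k) => |v i|)
      (h := fun v => f v i) (by fun_prop) (by fun_prop) (fun v => abs_nonneg _) (hzero i)
      (half_pos hη)
  choose δ hδ0 hδ using hδ
  obtain ⟨R, hR⟩ := hD.isBounded.exists_norm_le
  have hR' : ∀ v ∈ D, ∀ i, |v i| ≤ |R| := fun v hv i =>
    ((PiLp.norm_apply_le v i).trans (hR v hv)).trans (le_abs_self R)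
  obtain ⟨M, hM, happ⟩ := exists_isMLP_approx hσ hσ_nonpoly (κ := Fin k)
    (K := (fun (v : EuclideanSpace ℝ (Fin k)) i => |v i|) '' D) (hD.image (by fun_prop))
    (f := fun u i => f (WithLp.toLp 2 u) i / max (u i) (δ i))
    (continuous_pi fun i => Continuous.div₀ (by fun_prop) (by fun_prop)
      fun u => ((hδ0 i).trans_le (le_max_right _ _)).ne')
    (ε := η / 2 / (|R| + 1)) (by positivity)
  refine ⟨_, ⟨M, hM, rfl⟩, fun v hv => hnorm _ fun i => ?_⟩
  have h1 := happ _ ⟨v, hv, rfl⟩ i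
  have h2 := hδ i v hv
  set N := M fun i => |v i|
  set g := f (WithLp.toLp 2 fun j => |v j|) i / max |v i| (δ i) with hg
  have h3 : v i * g = |v i| * (f v i / max |v i| (δ i)) := by
    rw [hg, ← mul_div_assoc, hsym, mul_div_assoc]
  have h4 : |v i * (N i - g)| ≤ η / 2 := by
    rw [abs_mul]
    calc |v i| * |N i - g| ≤ (|R| + 1) * (η / 2 / (|R| + 1)) := by
          gcongr
          exact (hR' v hv i).trans (by linarith)
      _ = η / 2 := by field_simp
  have h5 : (vmul v (WithLp.toLp 2 N) - f v) i
      = v i * (N i - g) + (|v i| * (f v i / max |v i| (δ i)) - f v i) := by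
    rw [← h3]
    simp [vmul]
    ring
  rw [h5]
  exact (abs_add_le _ _).trans_lt (by linarith)

/-! ### Universality of SignNets for sign invariant functions -/

theorem eq_or_eq_neg_of_forall_mul_eq {n : ℕ} {v w : Fin n → ℝ}
    (h : ∀ a b, v a * v b = w a * w b) : v = w ∨ v = -w := by
  by_cases hv : v = 0
  · left
    ext a
    have := h a a
    rw [hv] at this ⊢
    have : w a = 0 := by simpa using this.symm
    simp [this]
  · obtain ⟨a, ha⟩ := Function.ne_iff.1 hv
    have ha : v a ≠ 0 := ha
    refine (mul_self_eq_mul_self_iff.1 (h a a)).imp (fun e => ?_) fun e => ?_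
    · ext b
      have := h a b
      rw [← e] at this
      exact mul_left_cancel₀ ha this
    · ext b
      have := h a b
      rw [← neg_eq_iff_eq_neg.2 e] at this
      exact mul_left_cancel₀ ha (by simpa using this)

theorem exists_isSign_mul_diagonal_eq {n k : ℕ} {V V' : Matrix (Fin n) (Fin k) ℝ}
    (h : ∀ a b j, V a j * V b j = V' a j * V' b j) :
    ∃ s : Fin k → ℝ, IsSign s ∧ V = V' * Matrix.diagonal s := by
  have : ∀ j, ∃ t : ℝ, (t = 1 ∨ t = -1) ∧ ∀ a, V a j = V' a j * t := fun j => by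
    rcases eq_or_eq_neg_of_forall_mul_eq (v := V.col j) (w := V'.col j) fun a b => h a b j with e | e
    · exact ⟨1, Or.inl rfl, fun a => by simpa using congrFun e a⟩
    · exact ⟨-1, Or.inr rfl, fun a => by simpa using congrFun e a⟩
  choose s hs hV using this
  exact ⟨s, hs, by ext a j; rw [Matrix.mul_diagonal, hV]⟩

/-- A sign invariant function of `V` is a function of the matrices `v_j v_jᵀ`. These are even in
`v_j`, so `φ` is made to approximate half of them, and `ρ` to approximate the function of them. -/
theorem exists_isSignNet_approx {σ : ℝ → ℝ} (hσ : Continuous σ)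
    (hσ_nonpoly : ¬ ∃ p : Polynomial ℝ, ∀ x, σ x = p.eval x) {n m k : ℕ}
    {D : Set (Matrix (Fin n) (Fin k) ℝ)} (hD : IsCompact D)
    {g : Matrix (Fin n) (Fin k) ℝ → Matrix (Fin m) (Fin k) ℝ} (hg : Continuous g)
    (hinv : ∀ s : Fin k → ℝ, IsSign s → ∀ V, g (V * Matrix.diagonal s) = g V)
    {ε : ℝ} (hε : 0 < ε) :
    ∃ S, IsSignNet σ S ∧ ∀ V ∈ D, ∀ i j, |S V i j - g V i j| < ε := by
  let e : Fin n × Fin n ≃ Fin (n * n) := finProdFinEquiv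
  let π : Matrix (Fin n) (Fin k) ℝ → (Fin k × Fin (n * n) → ℝ) := fun V p =>
    V (e.symm p.2).1 p.1 * V (e.symm p.2).2 p.1
  have hent : ∀ i j, Continuous fun V : Matrix (Fin n) (Fin k) ℝ => V i j := fun i j =>
    continuous_id.matrix_elem i j
  have hπ : Continuous π := continuous_pi fun p => (hent _ _).mul (hent _ _)
  obtain ⟨G, hG, hGg⟩ := exists_continuous_factor hD hπ
    (g := fun V (p : Fin m × Fin k) => g V p.1 p.2)
    (continuous_pi fun p => hg.matrix_elem p.1 p.2) fun V _ V' _ hVV' => by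
      obtain ⟨s, hs, rfl⟩ := exists_isSign_mul_diagonal_eq (V := V) (V' := V') fun a b j => by
        simpa [π] using congrFun hVV' (j, e (a, b))
      simp only [hinv s hs]
  -- The perceptron `ρ` is evaluated at approximations of the points of `π '' D`, so `G` has to be
  -- approximated on a neighbourhood of that set.
  have hT : IsCompact (Metric.cthickening 1 (π '' D)) := (hD.image hπ).cthickening
  obtain ⟨ρ, hρ, hρG⟩ := exists_isMLP_approx hσ hσ_nonpoly hT hG (half_pos hε)
  obtain ⟨δ, hδ, hδρ⟩ := Metric.uniformContinuousOn_iff.1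
    (hT.uniformContinuousOn_of_continuous (hρ.continuous hσ).continuousOn) (ε / 2) (half_pos hε)
  have hcol : ∀ j, Continuous fun V : Matrix (Fin n) (Fin k) ℝ => V.col j := fun j =>
    continuous_pi fun i => hent i j
  have hC : IsCompact (⋃ j, ((fun V : Matrix (Fin n) (Fin k) ℝ => V.col j) '' D ∪
      (fun V : Matrix (Fin n) (Fin k) ℝ => -V.col j) '' D)) :=
    isCompact_iUnion fun j => (hD.image (hcol j)).union (hD.image (hcol j).neg)
  have hη : 0 < min δ 1 / 2 := half_pos (lt_min hδ one_pos)
  obtain ⟨φ, hφ, hφq⟩ := exists_isMLP_approx hσ hσ_nonpoly hC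
    (f := fun v (p : Fin (n * n)) => v (e.symm p).1 * v (e.symm p).2 / 2) (by fun_prop) hη
  refine ⟨_, ⟨n * n, φ, ρ, hφ, hρ, rfl⟩, fun V hV i j => ?_⟩
  set u : Fin k × Fin (n * n) → ℝ := fun p => φ (V.col p.1) p.2 + φ (-V.col p.1) p.2 with hu
  have hdist : dist u (π V) < min δ 1 := by
    refine (dist_pi_lt_iff (lt_min hδ one_pos)).2 fun p => ?_
    have h1 := hφq _ (Set.mem_iUnion.2 ⟨p.1, Or.inl ⟨V, hV, rfl⟩⟩) p.2
    have h2 := hφq _ (Set.mem_iUnion.2 ⟨p.1, Or.inr ⟨V, hV, rfl⟩⟩) p.2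
    have h3 : u p - π V p
        = (φ (V.col p.1) p.2 - V.col p.1 (e.symm p.2).1 * V.col p.1 (e.symm p.2).2 / 2)
        + (φ (-V.col p.1) p.2
          - (-V.col p.1) (e.symm p.2).1 * (-V.col p.1) (e.symm p.2).2 / 2) := by
      simp only [hu, π, Pi.neg_apply, Matrix.col_apply]
      ring
    rw [Real.dist_eq, h3]
    exact (abs_add_le _ _).trans_lt (by linarith)
  have hmem : π V ∈ Metric.cthickening 1 (π '' D) :=
    Metric.self_subset_cthickening _ ⟨V, hV, rfl⟩
  have humem : u ∈ Metric.cthickening 1 (π '' D) :=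
    Metric.mem_cthickening_of_dist_le u (π V) 1 _ ⟨V, hV, rfl⟩
      (hdist.le.trans (min_le_right _ _))
  have h1 : |ρ u (i, j) - ρ (π V) (i, j)| < ε / 2 :=
    (dist_le_pi_dist (ρ u) (ρ (π V)) (i, j)).trans_lt
      (hδρ u humem _ hmem (hdist.trans_le (min_le_left _ _)))
  have h2 := hρG _ hmem (i, j)
  rw [hGg V hV] at h2
  have := abs_sub_le (ρ u (i, j)) (ρ (π V) (i, j)) (g V i j)
  exact this.trans_lt (by linarith)

/-! ### Sign equivariant functions of a matrix -/

theorem isSignNet_one (σ : ℝ → ℝ) (n m k : ℕ) :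
    IsSignNet σ fun (_ : Matrix (Fin n) (Fin k) ℝ) => Matrix.of fun (_ : Fin m) (_ : Fin k) => 1 :=
  ⟨0, fun _ => 0, fun _ => 1, isMLP_const σ 0, isMLP_const σ 1, rfl⟩

theorem MatSignEquivariant.apply_eq_zero {n n' k : ℕ}
    {f : Matrix (Fin n) (Fin k) ℝ → Matrix (Fin n') (Fin k) ℝ} (hf : MatSignEquivariant f)
    {V : Matrix (Fin n) (Fin k) ℝ} {j : Fin k} (hV : ∀ a, V a j = 0) (i : Fin n') :
    f V i j = 0 := by
  -- Flipping the sign of the vanishing `j`-th column fixes `V` and negates column `j` of `f V`.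
  have h1 : IsSign (Function.update (fun _ : Fin k => (1 : ℝ)) j (-1)) := fun l => by
    by_cases h : l = j
    · subst h; simp
    · simp [h]
  have h2 : V * Matrix.diagonal (Function.update (fun _ : Fin k => (1 : ℝ)) j (-1)) = V := by
    ext a l
    rw [Matrix.mul_diagonal]
    by_cases h : l = j
    · subst h; simp [hV]
    · simp [h]
  have h3 := congrFun (congrFun (hf _ h1 V) i) j
  rw [h2, Matrix.mul_diagonal, Function.update_self] at h3
  linarith

/-- The first layer produces the products `V a j * g V (a, i) j` with
`g V (a, i) j = V a j * f V i j / max ‖v_j‖² δ`, and the second layer sums over `a`. -/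
theorem isUniversal_matModel {σ : ℝ → ℝ} (hσ : Continuous σ)
    (hσ_nonpoly : ¬ ∃ p : Polynomial ℝ, ∀ x, σ x = p.eval x) (n n' k : ℕ) :
    IsUniversal (matModel σ n n' k) {f | Continuous f ∧ MatSignEquivariant f} := by
  rintro D hD f ⟨hf, hs⟩ ε hε
  obtain ⟨η, hη, hnorm⟩ := exists_pos_frobenius_norm_lt_of_abs_lt (m := n') (k := k) hε
  have hent : ∀ i j, Continuous fun V : Matrix (Fin n) (Fin k) ℝ => V i j := fun i j =>
    continuous_id.matrix_elem i j
  let q : Fin k → Matrix (Fin n) (Fin k) ℝ → ℝ := fun j V => ∑ a, V a j ^ 2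
  have hq : ∀ j, Continuous (q j) := fun j =>
    continuous_finsetSum _ fun a _ => (hent a j).pow 2
  have hδ : ∀ i j, ∃ δ > 0, ∀ V ∈ D, |q j V * (f V i j / max (q j V) δ) - f V i j| < η / 2 :=
    fun i j => exists_abs_mul_div_max_sub_lt hD (hq j) (hf.matrix_elem i j)
      (fun V => Finset.sum_nonneg fun a _ => sq_nonneg _)
      (fun V hV => hs.apply_eq_zero (fun a => by
        have := (Finset.sum_eq_zero_iff_of_nonneg fun a _ => sq_nonneg (V a j)).1 hV a
          (Finset.mem_univ a)
        simpa using this) i) (half_pos hη)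
  choose δ hδ0 hδ using hδ
  have hR : ∃ R > 0, ∀ V ∈ D, ∀ a j, |V a j| ≤ R := by
    have : ∀ p : Fin n × Fin k, ∃ R, ∀ V ∈ D, |V p.1 p.2| ≤ R := fun p => by
      obtain ⟨R, hR⟩ := (hD.image (hent p.1 p.2)).isBounded.exists_norm_le
      exact ⟨R, fun V hV => hR _ ⟨V, hV, rfl⟩⟩
    choose R hR using this
    refine ⟨1 + ∑ p, |R p|, by positivity, fun V hV a j => ?_⟩
    have := Finset.single_le_sum (f := fun p => |R p|) (fun p _ => abs_nonneg _)
      (Finset.mem_univ (a, j))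
    have := hR (a, j) V hV
    have := le_abs_self (R (a, j))
    dsimp only at *
    linarith
  obtain ⟨R, hR0, hR⟩ := hR
  let e : Fin n × Fin n' ≃ Fin (n * n') := finProdFinEquiv
  let g : Matrix (Fin n) (Fin k) ℝ → Matrix (Fin (n * n')) (Fin k) ℝ := fun V =>
    Matrix.of fun h j => V (e.symm h).1 j *
      (f V (e.symm h).2 j / max (q j V) (δ (e.symm h).2 j))
  have hg : Continuous g := continuous_matrix fun h j =>
    (hent _ _).mul <| Continuous.div₀ (hf.matrix_elem _ _) ((hq j).max continuous_const)
      fun V => ((hδ0 _ j).trans_le (le_max_right _ _)).ne'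
  have hinv : ∀ s : Fin k → ℝ, IsSign s → ∀ V, g (V * Matrix.diagonal s) = g V := by
    intro s hs1 V
    have hsq : ∀ j, s j * s j = 1 := fun j => by rcases hs1 j with h | h <;> simp [h]
    have hqi : ∀ j, q j (V * Matrix.diagonal s) = q j V := fun j =>
      Finset.sum_congr rfl fun a _ => by
        rw [Matrix.mul_diagonal, mul_pow, pow_two (s j), hsq, mul_one]
    ext h j
    simp only [g, Matrix.of_apply, hqi, hs s hs1 V, Matrix.mul_diagonal]
    calc _ = V (e.symm h).1 j * (f V (e.symm h).2 j / max (q j V) (δ (e.symm h).2 j)) *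
          (s j * s j) := by ring
      _ = _ := by rw [hsq, mul_one]
  obtain ⟨S, hS, hSg⟩ := exists_isSignNet_approx hσ hσ_nonpoly hD hg hinv
    (ε := η / 2 / (n * R + 1)) (by positivity)
  let W₁ : (Fin n → ℝ) →ₗ[ℝ] (Fin (n * n') → ℝ) := LinearMap.funLeft ℝ ℝ fun h => (e.symm h).1
  let W₂ : (Fin (n * n') → ℝ) →ₗ[ℝ] (Fin n' → ℝ) :=
    ∑ a, LinearMap.funLeft ℝ ℝ fun i => e (a, i)
  refine ⟨_, ⟨n * n', _, _, ⟨fun _ => W₁, S, hS, rfl⟩,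
    ⟨fun _ => W₂, _, isSignNet_one σ _ _ _, rfl⟩, rfl⟩, fun V hV => hnorm _ fun i j => ?_⟩
  have h1 : ∑ a, V a j * g V (e (a, i)) j = q j V * (f V i j / max (q j V) (δ i j)) := by
    simp only [g, q, Matrix.of_apply, Equiv.symm_apply_apply, Finset.sum_mul]
    exact Finset.sum_congr rfl fun a _ => by ring
  have h2 : |∑ a, V a j * (S V (e (a, i)) j - g V (e (a, i)) j)| ≤ η / 2 := by
    calc _ ≤ ∑ a, |V a j * (S V (e (a, i)) j - g V (e (a, i)) j)| :=
          Finset.abs_sum_le_sum_abs _ _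
      _ ≤ ∑ _a : Fin n, R * (η / 2 / (n * R + 1)) := Finset.sum_le_sum fun a _ => by
          rw [abs_mul]
          exact mul_le_mul (hR V hV a j) (hSg V hV _ j).le (abs_nonneg _) hR0.le
      _ = n * R / (n * R + 1) * (η / 2) := by
          simp only [Finset.sum_const, Finset.card_univ, Fintype.card_fin, nsmul_eq_mul]
          ring
      _ ≤ 1 * (η / 2) := by
          gcongr
          exact (div_le_one (by positivity)).2 (by linarith)
      _ = η / 2 := one_mul _
  have h3 := hδ i j V hV
  rw [← h1] at h3
  have h4 : (∑ a, V a j * S V (e (a, i)) j) - f V i j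
      = (∑ a, V a j * (S V (e (a, i)) j - g V (e (a, i)) j))
        + (∑ a, V a j * g V (e (a, i)) j - f V i j) := by
    simp only [mul_sub, Finset.sum_sub_distrib]
    ring
  have h5 : |(∑ a, V a j * S V (e (a, i)) j) - f V i j| < η := by
    rw [h4]
    exact (abs_add_le _ _).trans_lt (by linarith)
  simpa [W₁, W₂, LinearMap.funLeft_apply] using h5

end SignEquivariant

/-- For every continuous non-polynomial activation `σ`. -/
theorem mainTheorem2 (σ : ℝ → ℝ) (hσ : Continuous σ)
    (hσ_nonpoly : ¬ ∃ p : Polynomial ℝ, ∀ x, σ x = p.eval x) :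
    (∀ k : ℕ, SignEquivariant.IsUniversal (SignEquivariant.vecModel σ k)
      {f | Continuous f ∧ SignEquivariant.VecSignEquivariant f}) ∧
    (∀ n n' k : ℕ, SignEquivariant.IsUniversal (SignEquivariant.matModel σ n n' k)
      {f | Continuous f ∧ SignEquivariant.MatSignEquivariant f}) := by
  exact ⟨SignEquivariant.isUniversal_vecModel hσ hσ_nonpoly,
    SignEquivariant.isUniversal_matModel hσ hσ_nonpoly⟩
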